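/- Signals are sequences indexed by $t\in\mathbb N$. Let $n\ge 0$, $l\ge 0$, $m_1,\dots,m_n\ge 0$ be integers. For each $i=1,\dots,n$ let $\mathcal G_i$ be a linear, causal, time-invariant system mapping signals with values in $\mathbb R^{m_i}$ to signals with values in $\mathbb R^{l}$, with impulse response $(g_{i,t})_{t\ge 0}$, $g_{i,t}\in\mathbb R^{l\times m_i}$, and transfer function $\mathcal G_i(z)=\sum_{t\ge0} g_{i,t}z^{-t}$. Its $\mathcal H_\infty$ norm is $$\|\mathcal G_i\|_\infty=\operatorname*{ess\,sup}_{\omega\in[-\pi,\pi)}\sigma_{\max}\big(\mathcal G_i(e^{i\omega})\big)\in[0,\infty],$$ where $\sigma_{\max}$ is the maximum singular value and the series for $\mathcal G_i(e^{i\omega})$ converges in $L^2$; we set $\|\mathcal G_i\|_\infty=\infty$ if the impulse response is not square summable (in which case $\mathcal G_i$ is not stable). Put $\mathcal G(u_1,\dots,u_n)=\sum_{i=1}^n\mathcal G_iu_i$. Let $b_1,\dots,b_n\ge 0$. Call two inputs $u=(u_1,\dots,u_n)$ and $u'=(u_1',\dots,u_n')$, where $u_i,u_i'$ are arbitrary signals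 with values in $\mathbb R^{m_i}$, adjacent if for some $i$ one has $\|u_i-u_i'\|_2=\big(\sum_t|u_{i,t}-u'_{i,t}|^2\big)^{1/2}\le b_i$ and $u_j=u_j'$ for all $j\ne i$. Let $\epsilon>0$, $0<\delta<1$, let $\mathcal Q(x)=\frac1{\sqrt{2\pi}}\int_x^\infty e^{-u^2/2}\,du$, $K=\mathcal Q^{-1}(\delta)$, and $\kappa(\delta,\epsilon)=\frac1{2\epsilon}\big(K+\sqrt{K^2+2\epsilon}\big)$. Let $w=(w_t)_{t\ge0}$ be a white Gaussian noise: the $w_t$ are independent with $w_t\sim\mathcal N(0,\sigma^2I_{l})$, where $\sigma\ge 0$ and $$\sigma\ \ge\ \kappa(\delta,\epsilon)\,\max_{1\le i\le n}\{\|\mathcal G_i\|_\infty\, b_i\}$$ (with $\infty\cdot 0=0$, and the maximum being $0$ if $n=0$). Then the dynamic Gaussian mechanism $Mu=\mathcal Gu+w$ is $(\epsilon,\delta)$-differentially private: for every input $u$, $Mu$ is a random variable with values in the space of $\mathbb R^{l}$-valued signals with its product $\sigma$-algebra, and for all adjacent $u,u'$ there is a measure $\mu$ on this space, of total mass at most $\delta$,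 such that for every measurable set $S$ of signals $$\mathbb P(Mu\in S)\le e^{\epsilon}\,\mathbb P(Mu'\in S)+\mu(S).$$ -/

import Mathlib

open MeasureTheory ProbabilityTheory
open scoped ENNReal NNReal

noncomputable section

namespace PrivateFilter

/-! ### Differential privacy -/

/-- The mechanism `M : D → Ω → R` (a random variable `M d` for every dataset `d`) is
`(ε, δ)`-differentially private for the adjacency relation `Adj`: for adjacent `d`, `d'` there is a
measure `ν` on `R` of total mass at most `δ` with
`ℙ(M d ∈ S) ≤ e ^ ε ℙ(M d' ∈ S) + ν S` for all measurable `S`. -/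
def DifferentiallyPrivate {D R Ω : Type*} [MeasurableSpace R] [MeasurableSpace Ω]
    (P : Measure Ω) (Adj : D → D → Prop) (M : D → Ω → R) (ε δ : ℝ) : Prop :=
  (∀ d, Measurable (M d)) ∧
    ∀ d d', Adj d d' → ∃ ν : Measure R, ν Set.univ ≤ ENNReal.ofReal δ ∧
      ∀ S, MeasurableSet S →
        P {ω | M d ω ∈ S} ≤ ENNReal.ofReal (Real.exp ε) * P {ω | M d' ω ∈ S} + ν S

/-- The Gaussian tail function `𝒬 x = (2π)^(-1/2) ∫_x^∞ e^(-u²/2) du`. -/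
def gaussianQ (x : ℝ) : ℝ :=
  1 / Real.sqrt (2 * Real.pi) * ∫ u in Set.Ioi x, Real.exp (-u ^ 2 / 2)

/-- The inverse of `gaussianQ`, which is a bijection from `ℝ` onto `(0, 1)`; it is only meaningful
on `(0, 1)`. -/
def gaussianQInv (δ : ℝ) : ℝ := Function.invFun gaussianQ δ

/-- `κ(δ, ε) = (K + √(K² + 2ε)) / (2ε)` with `K = 𝒬⁻¹(δ)`. -/
def kappa (δ ε : ℝ) : ℝ :=
  1 / (2 * ε) * (gaussianQInv δ + Real.sqrt (gaussianQInv δ ^ 2 + 2 * ε))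

/-! ### Signals and systems -/

/-- Discrete-time signals with values in `ℝᵏ`, with time running over `ℕ`. Since a truncated signal
has only finitely many nonzero terms, this is the whole extended space `ℓ_{2,e}^k`; see
`l2Norm_truncate_lt_top`. -/
abbrev Signal (k : ℕ) : Type := ℕ → EuclideanSpace ℝ (Fin k)

/-- The `ℓ₂` norm of a signal, with value `∞` for signals of infinite energy. -/
def l2Norm {k : ℕ} (x : Signal k) : ℝ≥0∞ := (∑' t, ‖x t‖ₑ ^ 2) ^ (1 / 2 : ℝ)

/-- The truncation operator `P_T`. -/
def truncate {k : ℕ} (T : ℕ) (x : Signal k) : Signal k := fun t => if t ≤ T then x t else 0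

theorem l2Norm_truncate_lt_top {k : ℕ} (T : ℕ) (x : Signal k) : l2Norm (truncate T x) < ∞ := by
  unfold l2Norm
  refine ENNReal.rpow_lt_top_of_nonneg (by norm_num) ?_
  rw [tsum_eq_sum (s := Finset.range (T + 1))]
  · exact ENNReal.sum_ne_top.2 fun t _ => ENNReal.pow_ne_top enorm_ne_top
  · intro t ht
    have : ¬ t ≤ T := fun h => ht (Finset.mem_range.2 (Nat.lt_succ_of_le h))
    simp [truncate, this]

/-- The unit delay, with zero value at time `0`. -/
def delay {k : ℕ} (x : Signal k) : Signal k
  | 0 => 0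
  | t + 1 => x t

/-- Causality: `P_T 𝒢 = P_T 𝒢 P_T` for all `T`. -/
def IsCausal {k l : ℕ} (G : Signal k → Signal l) : Prop :=
  ∀ T x, truncate T (G x) = truncate T (G (truncate T x))

/-- Time invariance: the system commutes with the unit delay. -/
def IsTimeInvariant {k l : ℕ} (G : Signal k → Signal l) : Prop :=
  ∀ x, G (delay x) = delay (G x)

/-- The impulse response `g_t` of a linear system: column `j` of `g_t` is the output at time `t`
when the input is the `j`-th unit vector at time `0` and zero afterwards. -/
def impulseResponse {k l : ℕ} (G : Signal k →ₗ[ℝ] Signal l) (t : ℕ) :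
    Matrix (Fin l) (Fin k) ℝ :=
  Matrix.of fun i j => G (Pi.single 0 (EuclideanSpace.single j 1)) t i

instance fact_two_pi_pos : Fact (0 < 2 * Real.pi) := ⟨Real.two_pi_pos⟩

/-- The transfer function `𝒢(z) = ∑_t g_t z^(-t)` on the unit circle `z = e^(iω)`,
`ω ∈ ℝ / 2πℤ`. The series `∑_t g_t e^(-iωt)` is summed entrywise in `L²` of the circle, so
this is meaningful when the impulse response is square summable, and then defined up to a null set
of `ω`. -/
def freqResponse {k l : ℕ} (G : Signal k →ₗ[ℝ] Signal l) (ω : AddCircle (2 * Real.pi)) :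
    Matrix (Fin l) (Fin k) ℂ :=
  Matrix.of fun i j =>
    (∑' t : ℕ, ((impulseResponse G t i j : ℝ) : ℂ) • fourierLp 2 (-(t : ℤ)) :
      Lp ℂ 2 (AddCircle.haarAddCircle (T := 2 * Real.pi))) ω

/-- The maximum singular value of a matrix. -/
def sigmaMax {k l : ℕ} (A : Matrix (Fin l) (Fin k) ℂ) : ℝ :=
  (Matrix.toEuclideanLin A).singularValues 0

open Classical in
/-- The `ℋ_∞` norm `ess sup_ω σ_max (𝒢(e^(iω)))` of a causal linear time-invariant system. It is
`∞` when the impulse response is not square summable; a stable system (one with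
transfer function analytic and bounded on `|z| > 1`) has a square summable impulse response. -/
def hInfNorm {k l : ℕ} (G : Signal k →ₗ[ℝ] Signal l) : ℝ≥0∞ :=
  if ∀ i j, Summable fun t => impulseResponse G t i j ^ 2 then
    essSup (fun ω => ENNReal.ofReal (sigmaMax (freqResponse G ω)))
      (AddCircle.haarAddCircle (T := 2 * Real.pi))
  else ∞

/-! ### The dynamic Gaussian mechanism -/

/-- `Adj^b (u, u')`: for some participant `i`, `‖u_i - u'_i‖₂ ≤ b_i`, and `u_j = u'_j` for all
`j ≠ i`. -/
def Adj {n : ℕ} {m : Fin n → ℕ} (b : Fin n → ℝ≥0) (u u' : ∀ i, Signal (m i)) : Prop :=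
  ∃ i, l2Norm (u i - u' i) ≤ b i ∧ ∀ j, j ≠ i → u j = u' j

/-- `w` is a white Gaussian noise with `w_t ∼ 𝒩(0, σ² I_l)`: the random vectors `w_t` are
independent with this law. -/
structure IsWhiteGaussianNoise {Ω : Type*} [MeasurableSpace Ω] (P : Measure Ω) {l : ℕ}
    (σ : ℝ≥0) (w : ℕ → Ω → EuclideanSpace ℝ (Fin l)) : Prop where
  measurable : ∀ t, Measurable (w t)
  law : ∀ t, P.map (w t) =
    multivariateGaussian 0 ((σ : ℝ) ^ 2 • (1 : Matrix (Fin l) (Fin l) ℝ))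
  indep : iIndepFun w P

/-- The mechanism `M u = 𝒢 u + w` with `𝒢 (u_1, …, u_n) = ∑_i 𝒢_i u_i`. Its output is a signal,
and the space of signals carries the product σ-algebra. -/
def mechanism {Ω : Type*} {n l : ℕ} {m : Fin n → ℕ} (G : ∀ i, Signal (m i) →ₗ[ℝ] Signal l)
    (w : ℕ → Ω → EuclideanSpace ℝ (Fin l)) (u : ∀ i, Signal (m i)) (ω : Ω) : Signal l :=
  fun t => (∑ i, G i (u i)) t + w t ω

end PrivateFilter

end

namespace PrivateFilter

/-! Two independent facts combine: a bound on how far adjacent inputs can push the outputs apart,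
and the privacy of white Gaussian noise under a bounded translation.

Sensitivity: for adjacent inputs the outputs differ by `G i (u i - u' i)`. By Parseval the energy of
this signal is an integral over the circle, where `sigmaMax` of the frequency response bounds the
gain at almost every frequency; hence `l2Norm_map_le`. Parseval is applied to truncated inputs, and
causality removes the truncation.

Noise: on finitely many times the noise is an isotropic Gaussian vector. Translating it by `v`
changes only its component along `v`, so everything reduces to a real Gaussian shifted by `s = ‖v‖`
(`translate_le_exp_mul_add`). There the density ratio exceeds `exp ε` only beyond a threshold, and
the shifted Gaussian gives that tail mass at most `δ` once `σ ≥ kappa δ ε * s`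
(`gaussianReal_le_exp_mul_add`). Approximation by cylinders extends the bound to all measurable sets
of signals, and a Hahn decomposition turns the additive constant `δ` into a measure. -/

/-! ### The Gaussian tail function and privacy of a real Gaussian -/

theorem gaussianQ_eq_measureReal (x : ℝ) : gaussianQ x = (gaussianReal 0 1).real (Set.Ioi x) := by
  rw [measureReal_def, gaussianReal_apply_eq_integral 0 one_ne_zero, ENNReal.toReal_ofReal
    (integral_nonneg fun _ => gaussianPDFReal_nonneg _ _ _), gaussianQ, ← integral_const_mul]
  simp [gaussianPDFReal]

theorem gaussianQ_antitone : Antitone gaussianQ := fun x y h => by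
  rw [gaussianQ_eq_measureReal, gaussianQ_eq_measureReal]
  exact measureReal_mono (Set.Ioi_subset_Ioi h)

theorem gaussianQ_eq_one_sub_cdf (x : ℝ) : gaussianQ x = 1 - cdf (gaussianReal 0 1) x := by
  rw [gaussianQ_eq_measureReal, cdf_eq_real, ← Set.compl_Iic,
    measureReal_compl measurableSet_Iic, probReal_univ]

theorem continuous_gaussianQ : Continuous gaussianQ := by
  have hint : Integrable fun u : ℝ => Real.exp (-u ^ 2 / 2) := by
    convert! integrable_exp_neg_mul_sq (b := 1 / 2) (by norm_num) using 3
    ring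
  have h : gaussianQ = fun x => 1 / Real.sqrt (2 * Real.pi) *
      ((∫ u in Set.Ioi 0, Real.exp (-u ^ 2 / 2)) - ∫ u in (0 : ℝ)..x, Real.exp (-u ^ 2 / 2)) := by
    ext x
    rw [gaussianQ, ← intervalIntegral.integral_interval_add_Ioi (a := 0) (b := x)
      hint.integrableOn hint.integrableOn, add_sub_cancel_left]
  rw [h]
  exact continuous_const.mul (continuous_const.sub (hint.continuous_primitive 0))

theorem exists_gaussianQ_eq {δ : ℝ} (h₀ : 0 < δ) (h₁ : δ < 1) : ∃ x, gaussianQ x = δ := by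
  have hbot : Filter.Tendsto gaussianQ Filter.atBot (nhds 1) := by
    have := (tendsto_cdf_atBot (gaussianReal 0 1)).const_sub 1
    simpa [funext gaussianQ_eq_one_sub_cdf] using this
  have htop : Filter.Tendsto gaussianQ Filter.atTop (nhds 0) := by
    have := (tendsto_cdf_atTop (gaussianReal 0 1)).const_sub 1
    simpa [funext gaussianQ_eq_one_sub_cdf] using this
  obtain ⟨x, hx⟩ := ((hbot.eventually (lt_mem_nhds h₁))).exists
  obtain ⟨y, hy⟩ := ((htop.eventually (gt_mem_nhds h₀))).exists
  exact mem_range_of_exists_le_of_exists_ge continuous_gaussianQ ⟨y, hy.le⟩ ⟨x, hx.le⟩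

theorem gaussianQ_gaussianQInv {δ : ℝ} (h₀ : 0 < δ) (h₁ : δ < 1) :
    gaussianQ (gaussianQInv δ) = δ :=
  Function.invFun_eq (exists_gaussianQ_eq h₀ h₁)

theorem kappa_pos (δ : ℝ) {ε : ℝ} (hε : 0 < ε) : 0 < kappa δ ε := by
  have h : |gaussianQInv δ| < Real.sqrt (gaussianQInv δ ^ 2 + 2 * ε) := by
    rw [← Real.sqrt_sq_eq_abs]
    exact Real.sqrt_lt_sqrt (sq_nonneg _) (by linarith)
  have := neg_abs_le (gaussianQInv δ)
  unfold kappa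
  have : 0 < gaussianQInv δ + Real.sqrt (gaussianQInv δ ^ 2 + 2 * ε) := by linarith
  positivity

/-- With `x = σ / s` the conclusion reads `2εx² - 2Kx - 1 ≥ 0`, and `kappa δ ε` is the positive root
of this quadratic. -/
theorem gaussianQInv_le_of_kappa_mul_le {δ ε s σ : ℝ} (hε : 0 < ε) (hs : 0 < s) (hσ : 0 < σ)
    (h : kappa δ ε * s ≤ σ) : gaussianQInv δ ≤ σ * ε / s - s / (2 * σ) := by
  set K := gaussianQInv δ with hK
  set r := Real.sqrt (K ^ 2 + 2 * ε) with hr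
  have hr2 : r ^ 2 = K ^ 2 + 2 * ε := Real.sq_sqrt (by positivity)
  have hr0 : 0 ≤ r := Real.sqrt_nonneg _
  have hlt : K < r := by nlinarith
  have h' : (K + r) * s ≤ 2 * ε * σ := by
    have : kappa δ ε * s = (K + r) * s / (2 * ε) := by
      rw [kappa, ← hK, ← hr]; ring
    rw [this, div_le_iff₀ (by positivity)] at h
    linarith
  -- Multiply `h'` by the conjugate: `(r - K) * (r + K) = 2ε`.
  have hs' : s ≤ (r - K) * σ := by
    have : 2 * ε * s ≤ (r - K) * σ * (2 * ε) := by
      calc 2 * ε * s = (r - K) * ((K + r) * s) := by linear_combination -s * hr2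
        _ ≤ (r - K) * (2 * ε * σ) := mul_le_mul_of_nonneg_left h' (by linarith)
        _ = _ := by ring
    nlinarith
  have key : s ^ 2 + 2 * K * s * σ ≤ 2 * σ ^ 2 * ε := by
    have : (s + K * σ) ^ 2 ≤ (r * σ) ^ 2 := by
      apply sq_le_sq'
      · have hneg : -r < K := by nlinarith
        nlinarith
      · linarith
    nlinarith
  rw [div_sub_div _ _ hs.ne' (by positivity), le_div_iff₀ (by positivity)]
  nlinarith

theorem gaussianReal_Ioi (s : ℝ) {σ : ℝ≥0} (hσ : σ ≠ 0) (a : ℝ) :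
    gaussianReal s (σ ^ 2) (Set.Ioi a) = ENNReal.ofReal (gaussianQ ((a - s) / σ)) := by
  have h : gaussianReal s (σ ^ 2) = (gaussianReal 0 1).map fun x => s + (σ : ℝ) * x := by
    have hcomp : (fun x : ℝ => s + (σ : ℝ) * x) = (fun x => s + x) ∘ fun x => (σ : ℝ) * x := rfl
    rw [hcomp, ← Measure.map_map (by fun_prop) (by fun_prop),
      gaussianReal_map_const_mul, gaussianReal_map_const_add]
    simp only [mul_zero, zero_add, mul_one]
    rfl
  have hpos : (0 : ℝ) < σ := by positivity
  rw [h, Measure.map_apply (by fun_prop) measurableSet_Ioi, gaussianQ_eq_measureReal,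
    ofReal_measureReal]
  congr 1
  ext x
  simp only [Set.mem_preimage, Set.mem_Ioi, div_lt_iff₀ hpos]
  constructor <;> intro <;> linarith

/-- A real Gaussian and its translate by `s` are indistinguishable up to `(ε, δ)` when the standard
deviation is at least `kappa δ ε * s`. -/
theorem gaussianReal_le_exp_mul_add {δ ε s : ℝ} {σ : ℝ≥0} (hε : 0 < ε) (hδ₀ : 0 < δ) (hδ₁ : δ < 1)
    (hs : 0 < s) (h : kappa δ ε * s ≤ σ) {S : Set ℝ} (hS : MeasurableSet S) :
    gaussianReal s (σ ^ 2) S ≤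
      ENNReal.ofReal (Real.exp ε) * gaussianReal 0 (σ ^ 2) S + ENNReal.ofReal δ := by
  have hσ : (0 : ℝ) < σ := (mul_pos (kappa_pos δ hε) hs).trans_le h
  have hσ' : σ ≠ 0 := by exact_mod_cast hσ.ne'
  have hv : σ ^ 2 ≠ 0 := pow_ne_zero _ hσ'
  -- The log density ratio of the shifted to the centred Gaussian at `z` is `(z s - s²/2) / σ²`; it
  -- equals `ε` at `z = a`.
  set a : ℝ := σ ^ 2 * ε / s + s / 2 with ha
  have h1 : gaussianReal s (σ ^ 2) (S ∩ Set.Iic a) ≤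
      ENNReal.ofReal (Real.exp ε) * gaussianReal 0 (σ ^ 2) (S ∩ Set.Iic a) := by
    rw [gaussianReal_apply _ hv, gaussianReal_apply _ hv,
      ← lintegral_const_mul _ (measurable_gaussianPDF _ _)]
    refine setLIntegral_mono' (hS.inter measurableSet_Iic) fun z hz => ?_
    rw [gaussianPDF, gaussianPDF, ← ENNReal.ofReal_mul (Real.exp_pos _).le]
    refine ENNReal.ofReal_le_ofReal ?_
    rw [gaussianPDFReal, gaussianPDFReal, mul_left_comm, ← Real.exp_add]
    gcongr
    have hz' : z ≤ a := hz.2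
    have : z * s ≤ σ ^ 2 * ε + s ^ 2 / 2 := by
      calc z * s ≤ a * s := by gcongr
        _ = _ := by rw [ha]; field_simp
    push_cast
    rw [← sub_nonneg]
    have : ε + -(z - 0) ^ 2 / (2 * (σ : ℝ) ^ 2) - -(z - s) ^ 2 / (2 * (σ : ℝ) ^ 2) =
        (σ ^ 2 * ε + s ^ 2 / 2 - z * s) / σ ^ 2 := by
      field_simp
      ring
    rw [this]
    exact div_nonneg (by linarith) (by positivity)
  -- The standardized threshold `(a - s) / σ` is `σ ε / s - s / (2σ)`, which is at least
  -- `gaussianQInv δ`.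
  have h2 : gaussianReal s (σ ^ 2) (Set.Ioi a) ≤ ENNReal.ofReal δ := by
    rw [gaussianReal_Ioi s hσ']
    refine ENNReal.ofReal_le_ofReal ?_
    rw [← gaussianQ_gaussianQInv hδ₀ hδ₁]
    refine gaussianQ_antitone ((gaussianQInv_le_of_kappa_mul_le hε hs hσ h).trans_eq ?_)
    rw [ha]
    field_simp
    ring
  calc gaussianReal s (σ ^ 2) S
      ≤ gaussianReal s (σ ^ 2) (S ∩ Set.Iic a) + gaussianReal s (σ ^ 2) (Set.Ioi a) := by
        refine (measure_mono fun z hz => ?_).trans (measure_union_le _ _)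
        rcases le_or_gt z a with hza | hza
        · exact Or.inl ⟨hz, hza⟩
        · exact Or.inr hza
    _ ≤ _ := by
        refine add_le_add (h1.trans ?_) h2
        gcongr
        exact Set.inter_subset_left

/-! ### Reduction of isotropic Gaussian vectors to one dimension -/

section Isotropic

variable {F : Type*} [NormedAddCommGroup F] [InnerProductSpace ℝ F] [CompleteSpace F]
  [SecondCountableTopology F] [MeasurableSpace F] [BorelSpace F]

/-- The component of an isotropic Gaussian vector along a unit vector can be replaced by an
independent real Gaussian variable. -/
theorem map_prod_gaussianReal_eq {ρ : Measure F} [IsProbabilityMeasure ρ] {σ : ℝ≥0}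
    (hρ : ∀ t, charFun ρ t = Complex.exp (-((σ ^ 2 * ‖t‖ ^ 2 / 2 : ℝ) : ℂ))) {e : F}
    (he : ‖e‖ = 1) :
    ((gaussianReal 0 (σ ^ 2)).prod ρ).map
      (fun p => p.1 • e + (p.2 - inner ℝ e p.2 • e)) = ρ := by
  have hm : Measurable fun p : ℝ × F => p.1 • e + (p.2 - inner ℝ e p.2 • e) :=
    Continuous.measurable (by fun_prop)
  have : IsProbabilityMeasure (((gaussianReal 0 (σ ^ 2)).prod ρ).map
      fun p => p.1 • e + (p.2 - inner ℝ e p.2 • e)) :=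
    Measure.isProbabilityMeasure_map hm.aemeasurable
  refine Measure.ext_of_charFun (funext fun t => ?_)
  have hee : inner ℝ e e = 1 := by rw [real_inner_self_eq_norm_sq, he, one_pow]
  -- The new vector pairs with `t` through `p.1` against `⟨e, t⟩` and `p.2` against the part of `t`
  -- orthogonal to `e`. The characteristic function therefore factors, and Pythagoras (`hnorm`)
  -- recombines the two exponents.
  have key : ∀ p : ℝ × F, Complex.exp (inner ℝ (p.1 • e + (p.2 - inner ℝ e p.2 • e)) t * Complex.I) =
      Complex.exp (inner ℝ p.1 (inner ℝ e t) * Complex.I) *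
        Complex.exp (inner ℝ p.2 (t - inner ℝ e t • e) * Complex.I) := by
    intro p
    rw [← Complex.exp_add, ← add_mul, ← Complex.ofReal_add]
    congr 3
    simp only [inner_add_left, inner_sub_left, inner_sub_right, real_inner_smul_left,
      real_inner_smul_right, RCLike.inner_apply, conj_trivial]
    rw [real_inner_comm e p.2]
    ring
  have hnorm : (inner ℝ e t) ^ 2 + ‖t - inner ℝ e t • e‖ ^ 2 = ‖t‖ ^ 2 := by
    rw [← real_inner_self_eq_norm_sq, ← real_inner_self_eq_norm_sq]
    simp only [inner_sub_left, inner_sub_right, real_inner_smul_left, real_inner_smul_right, hee]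
    rw [real_inner_comm t e]
    ring
  rw [charFun_apply, integral_map hm.aemeasurable
    (Continuous.aestronglyMeasurable (by fun_prop)), integral_congr_ae (ae_of_all _ key),
    integral_prod_mul (fun z : ℝ => Complex.exp (inner ℝ z (inner ℝ e t) * Complex.I))
      (fun y : F => Complex.exp (inner ℝ y (t - inner ℝ e t • e) * Complex.I)),
    ← charFun_apply, ← charFun_apply, hρ, hρ, charFun_gaussianReal, ← Complex.exp_add, ← hnorm]
  congr 1
  push_cast
  ring

/-- Privacy of an isotropic Gaussian translated by a vector `v`. -/
theorem translate_le_exp_mul_add {ρ : Measure F} [IsProbabilityMeasure ρ] {σ : ℝ≥0}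
    (hρ : ∀ t, charFun ρ t = Complex.exp (-((σ ^ 2 * ‖t‖ ^ 2 / 2 : ℝ) : ℂ))) {δ ε : ℝ}
    (hε : 0 < ε) (hδ₀ : 0 < δ) (hδ₁ : δ < 1) {v : F} (h : kappa δ ε * ‖v‖ ≤ σ) {S : Set F}
    (hS : MeasurableSet S) :
    ρ {x | v + x ∈ S} ≤ ENNReal.ofReal (Real.exp ε) * ρ S + ENNReal.ofReal δ := by
  -- The zero shift has no direction, and it is the only case compatible with `σ = 0`.
  rcases eq_or_ne v 0 with rfl | hv
  · simp only [zero_add, Set.ofPred_mem_eq]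
    refine le_add_right ?_
    conv_lhs => rw [← one_mul (ρ S)]
    gcongr
    rw [← ENNReal.ofReal_one]
    exact ENNReal.ofReal_le_ofReal (Real.one_le_exp hε.le)
  have hv' : 0 < ‖v‖ := norm_pos_iff.2 hv
  set e : F := ‖v‖⁻¹ • v with he
  have hve : v = ‖v‖ • e := by rw [he, smul_smul, mul_inv_cancel₀ hv'.ne', one_smul]
  have he1 : ‖e‖ = 1 := by rw [he, norm_smul, norm_inv, norm_norm, inv_mul_cancel₀ hv'.ne']
  set Φ : ℝ × F → F := fun p => p.1 • e + (p.2 - inner ℝ e p.2 • e) with hΦ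
  have hm : Measurable Φ := Continuous.measurable (by fun_prop)
  have hmap := map_prod_gaussianReal_eq hρ he1
  have hmv : Measurable fun x : F => v + x := by fun_prop
  -- Slice `ρ` along lines parallel to `e`: for fixed `y` only the real Gaussian coordinate varies,
  -- and by `hshift` translation by `v` just moves its mean to `‖v‖`.
  have hsec : ∀ T : Set F, MeasurableSet T →
      ρ T = ∫⁻ y, gaussianReal 0 (σ ^ 2) {z | Φ (z, y) ∈ T} ∂ρ := by
    intro T hT
    conv_lhs => rw [← hmap]
    rw [Measure.map_apply hm hT, Measure.prod_apply_symm (hm hT)]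
    rfl
  have hshift : ∀ y, gaussianReal 0 (σ ^ 2) {z | Φ (z, y) ∈ {x | v + x ∈ S}} =
      gaussianReal ‖v‖ (σ ^ 2) {z | Φ (z, y) ∈ S} := by
    intro y
    have hmy : MeasurableSet {z | Φ (z, y) ∈ S} := (hm.comp (by fun_prop)) hS
    rw [← zero_add ‖v‖, ← gaussianReal_map_const_add, Measure.map_apply (by fun_prop) hmy]
    congr 1
    ext z
    have : v + Φ (z, y) = Φ (‖v‖ + z, y) := by
      simp only [hΦ, add_smul, ← hve, add_assoc]
    simp only [Set.mem_ofPred_eq, Set.mem_preimage, this]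
  rw [hsec {x | v + x ∈ S} (hmv hS), lintegral_congr hshift, hsec S hS,
    ← lintegral_const_mul' _ _ ENNReal.ofReal_ne_top]
  calc ∫⁻ y, gaussianReal ‖v‖ (σ ^ 2) {z | Φ (z, y) ∈ S} ∂ρ
      ≤ ∫⁻ y, (ENNReal.ofReal (Real.exp ε) * gaussianReal 0 (σ ^ 2) {z | Φ (z, y) ∈ S} +
          ENNReal.ofReal δ) ∂ρ :=
        lintegral_mono fun y => gaussianReal_le_exp_mul_add hε hδ₀ hδ₁ hv' h
          ((hm.comp (by fun_prop)) hS)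
    _ = _ := by rw [lintegral_add_right _ measurable_const, lintegral_const, measure_univ, mul_one]

end Isotropic

/-! ### Extending set inequalities and representing their defect -/

/-- An inequality `μ ≤ c ν + δ` between finite measures on a product space extends from cylinders to
all measurable sets. -/
theorem le_mul_add_of_forall_measurableCylinders {ι : Type*} {α : ι → Type*}
    [∀ i, MeasurableSpace (α i)] {μ ν : Measure (∀ i, α i)} [IsFiniteMeasure μ] [IsFiniteMeasure ν]
    {c d : ℝ≥0∞} (hc : c ≠ ∞)
    (h : ∀ S ∈ measurableCylinders α, μ S ≤ c * ν S + d) {S : Set (∀ i, α i)}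
    (hS : MeasurableSet S) : μ S ≤ c * ν S + d := by
  have halg : IsSetAlgebra (measurableCylinders α) :=
    ⟨empty_mem_measurableCylinders α, fun _ => compl_mem_measurableCylinders,
      fun _ _ => union_mem_measurableCylinders⟩
  -- Density for the sum `μ + ν` yields one cylinder that approximates `S` in both measures at once.
  have hdense : (μ + ν).MeasureDense (measurableCylinders α) :=
    Measure.MeasureDense.of_generateFrom_isSetAlgebra_finite _ halg
      generateFrom_measurableCylinders.symm
  have hlim : Filter.Tendsto (fun r : ℝ => c * (ν S + ENNReal.ofReal r) + d + ENNReal.ofReal r)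
      (nhdsWithin 0 (Set.Ioi 0)) (nhds (c * (ν S + ENNReal.ofReal 0) + d + ENNReal.ofReal 0)) := by
    have h0 : Filter.Tendsto ENNReal.ofReal (nhdsWithin 0 (Set.Ioi 0)) (nhds (ENNReal.ofReal 0)) :=
      ENNReal.continuous_ofReal.continuousAt.mono_left nhdsWithin_le_nhds
    exact ((ENNReal.Tendsto.const_mul (tendsto_const_nhds.add h0) (Or.inr hc)).add_const d).add h0
  rw [ENNReal.ofReal_zero, add_zero, add_zero] at hlim
  refine ge_of_tendsto hlim (eventually_nhdsWithin_of_forall fun r hr => ?_)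
  obtain ⟨T, hT, hST⟩ := hdense.approx S hS (measure_ne_top _ _) r hr
  rw [Measure.add_apply] at hST
  have h1 : μ S ≤ μ T + μ (symmDiff S T) := by
    refine (measure_mono fun x hx => ?_).trans (measure_union_le _ _)
    by_cases hxT : x ∈ T
    · exact Or.inl hxT
    · exact Or.inr (Or.inl ⟨hx, hxT⟩)
  have h2 : ν T ≤ ν S + ν (symmDiff S T) := by
    refine (measure_mono fun x hx => ?_).trans (measure_union_le _ _)
    by_cases hxS : x ∈ S
    · exact Or.inl hxS
    · exact Or.inr (Or.inr ⟨hx, hxS⟩)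
  calc μ S ≤ μ T + μ (symmDiff S T) := h1
    _ ≤ c * ν T + d + μ (symmDiff S T) := by gcongr; exact h T hT
    _ ≤ c * (ν S + ν (symmDiff S T)) + d + μ (symmDiff S T) := by gcongr
    _ ≤ _ := by
      gcongr
      · exact le_add_self.trans hST.le
      · exact le_self_add.trans hST.le

/-- An inequality `μ ≤ c ν + δ` between finite measures is witnessed by a measure of total mass at
most `δ`. -/
theorem exists_measure_le_mul_add {R : Type*} [MeasurableSpace R] {μ ν : Measure R}
    [IsFiniteMeasure μ] [IsFiniteMeasure ν] {c d : ℝ≥0∞} (hc : c ≠ ∞)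
    (h : ∀ S, MeasurableSet S → μ S ≤ c * ν S + d) :
    ∃ τ : Measure R, τ Set.univ ≤ d ∧ ∀ S, MeasurableSet S → μ S ≤ c * ν S + τ S := by
  have hfin : IsFiniteMeasure (c • ν) := ν.smul_finite hc
  obtain ⟨s, hs, h1, h2⟩ := hahn_decomposition μ (c • ν)
  have hle : (c • ν).restrict s ≤ μ.restrict s := by
    refine Measure.le_iff.2 fun t ht => ?_
    rw [Measure.restrict_apply ht, Measure.restrict_apply ht]
    exact h1 _ (ht.inter hs) Set.inter_subset_right
  -- The witness is the positive part of `μ - c ν`, carried by the Hahn set `s`. Its mass is `μ s -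
  -- c ν s`, so the hypothesis at `s` alone bounds it.
  refine ⟨(μ - c • ν).restrict s, ?_, fun S hS => ?_⟩
  · rw [Measure.restrict_sub_eq_restrict_sub_restrict hs,
      Measure.sub_apply MeasurableSet.univ hle, Measure.restrict_apply_univ,
      Measure.restrict_apply_univ, tsub_le_iff_left]
    exact h s hs
  · rw [Measure.restrict_sub_eq_restrict_sub_restrict hs, Measure.sub_apply hS hle,
      Measure.restrict_apply hS, Measure.restrict_apply hS, ← measure_inter_add_sdiff S hs,
      ← smul_eq_mul, ← Measure.smul_apply, ← measure_inter_add_sdiff (μ := c • ν) S hs]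
    have h3 : μ (S \ s) ≤ (c • ν) (S \ s) := h2 _ (hS.diff hs) fun x hx => hx.2
    have h4 : μ (S ∩ s) ≤ (c • ν) (S ∩ s) + (μ (S ∩ s) - (c • ν) (S ∩ s)) := le_add_tsub
    calc _ ≤ _ := add_le_add h4 h3
      _ = _ := by rw [add_right_comm]

/-! ### Privacy of white Gaussian noise on the space of signals -/

section Noise

variable {Ω : Type*} [MeasurableSpace Ω] {P : Measure Ω} {l : ℕ} {σ : ℝ≥0}
  {w : ℕ → Ω → EuclideanSpace ℝ (Fin l)}

theorem IsWhiteGaussianNoise.measurable_add (hw : IsWhiteGaussianNoise P σ w) (c : Signal l) :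
    Measurable fun ω t => c t + w t ω :=
  measurable_pi_lambda _ fun t => (hw.measurable t).const_add (c t)

variable [IsProbabilityMeasure P]

/-- Independence multiplies the characteristic functions, and the exponents add up to `‖t‖²` because
the window of times carries the `ℓ₂` norm. This is the hypothesis `hρ` of
`translate_le_exp_mul_add`, stated so as to include `σ = 0`. -/
theorem IsWhiteGaussianNoise.charFun_restrict (hw : IsWhiteGaussianNoise P σ w) (I : Finset ℕ)
    (t : PiLp 2 fun _ : I => EuclideanSpace ℝ (Fin l)) :
    charFun (P.map fun ω => WithLp.toLp 2 fun i : I => w i ω) t =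
      Complex.exp (-((σ ^ 2 * ‖t‖ ^ 2 / 2 : ℝ) : ℂ)) := by
  have hindep : iIndepFun (fun i : I => w i) P := hw.indep.precomp Subtype.val_injective
  rw [(iIndepFun_iff_charFun_pi fun i => (hw.measurable _).aemeasurable).1 hindep t]
  have hpos : ((σ : ℝ) ^ 2 • (1 : Matrix (Fin l) (Fin l) ℝ)).PosSemidef :=
    Matrix.PosSemidef.one.smul (sq_nonneg _)
  have hterm : ∀ i : I, charFun (P.map (w i)) (t i) =
      Complex.exp (-((σ ^ 2 * ‖t i‖ ^ 2 / 2 : ℝ) : ℂ)) := by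
    intro i
    rw [hw.law, charFun_multivariateGaussian hpos]
    congr 1
    rw [EuclideanSpace.real_norm_sq_eq, Matrix.smul_mulVec, Matrix.one_mulVec, dotProduct_smul]
    simp [dotProduct, sq]
  rw [Finset.prod_congr rfl fun i _ => hterm i, ← Complex.exp_sum, PiLp.norm_sq_eq_of_L2,
    Finset.mul_sum, Finset.sum_div, Complex.ofReal_sum, Finset.sum_neg_distrib]

/-- Adding white Gaussian noise to two deterministic signals at bounded `ℓ₂` distance makes them
indistinguishable up to `(ε, δ)`. -/
theorem IsWhiteGaussianNoise.measure_le_exp_mul_add (hw : IsWhiteGaussianNoise P σ w) {δ ε : ℝ}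
    (hε : 0 < ε) (hδ₀ : 0 < δ) (hδ₁ : δ < 1) {c c' : Signal l}
    (h : ENNReal.ofReal (kappa δ ε) * l2Norm (c - c') ≤ σ) {S : Set (Signal l)}
    (hS : MeasurableSet S) :
    P {ω | (fun t => c t + w t ω) ∈ S} ≤
      ENNReal.ofReal (Real.exp ε) * P {ω | (fun t => c' t + w t ω) ∈ S} + ENNReal.ofReal δ := by
  have hm := hw.measurable_add c
  have hm' := hw.measurable_add c'
  have : IsProbabilityMeasure (P.map fun ω t => c t + w t ω) :=
    Measure.isProbabilityMeasure_map hm.aemeasurable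
  have : IsProbabilityMeasure (P.map fun ω t => c' t + w t ω) :=
    Measure.isProbabilityMeasure_map hm'.aemeasurable
  suffices hmap : (P.map fun ω t => c t + w t ω) S ≤ ENNReal.ofReal (Real.exp ε) *
      (P.map fun ω t => c' t + w t ω) S + ENNReal.ofReal δ by
    rwa [Measure.map_apply hm hS, Measure.map_apply hm' hS] at hmap
  refine le_mul_add_of_forall_measurableCylinders ENNReal.ofReal_ne_top (fun S hS => ?_) hS
  obtain ⟨I, T, hT, rfl⟩ := (mem_measurableCylinders _).1 hS
  have hcyl : MeasurableSet (cylinder (α := fun _ => EuclideanSpace ℝ (Fin l)) I T) :=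
    MeasurableSet.of_mem_measurableCylinders hS
  set X : Ω → PiLp 2 fun _ : I => EuclideanSpace ℝ (Fin l) :=
    fun ω => WithLp.toLp 2 fun i : I => w i ω with hX
  have hXm : Measurable X := (WithLp.measurable_toLp 2 _).comp
    (measurable_pi_lambda _ fun i => hw.measurable i)
  have : IsProbabilityMeasure (P.map X) := Measure.isProbabilityMeasure_map hXm.aemeasurable
  set v : PiLp 2 fun _ : I => EuclideanSpace ℝ (Fin l) :=
    WithLp.toLp 2 fun i : I => c i - c' i with hv
  -- Recentring at `c'` turns the two events into `v + X ∈ T'` and `X ∈ T'`, so only the difference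
  -- `v` remains.
  set T' : Set (PiLp 2 fun _ : I => EuclideanSpace ℝ (Fin l)) :=
    {x | (fun i : I => c' i + x i) ∈ T} with hT'
  have hT'm : MeasurableSet T' := by
    refine measurableSet_preimage (measurable_pi_lambda _ fun i => ?_) hT
    exact Continuous.measurable (by fun_prop)
  have hnorm : ENNReal.ofReal ‖v‖ ≤ l2Norm (c - c') := by
    have hsq : ENNReal.ofReal ‖v‖ = (∑ i : I, ‖c i - c' i‖ₑ ^ 2) ^ (1 / 2 : ℝ) := by
      have : ∑ i : I, ‖c i - c' i‖ₑ ^ 2 = ENNReal.ofReal (‖v‖ ^ 2) := by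
        rw [PiLp.norm_sq_eq_of_L2, ENNReal.ofReal_sum_of_nonneg fun _ _ => sq_nonneg _]
        refine Finset.sum_congr rfl fun i _ => ?_
        rw [ENNReal.ofReal_pow (norm_nonneg _), ofReal_norm]
      rw [this, ENNReal.ofReal_rpow_of_nonneg (sq_nonneg _) (by norm_num), ← Real.sqrt_eq_rpow,
        Real.sqrt_sq (norm_nonneg _)]
    rw [hsq, l2Norm]
    refine ENNReal.rpow_le_rpow ?_ (by norm_num)
    rw [Finset.sum_coe_sort I fun i => ‖c i - c' i‖ₑ ^ 2]
    exact ENNReal.sum_le_tsum I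
  have hle : kappa δ ε * ‖v‖ ≤ σ := by
    have h1 : ENNReal.ofReal (kappa δ ε * ‖v‖) ≤ ENNReal.ofReal σ := by
      rw [ENNReal.ofReal_mul (kappa_pos δ hε).le, ENNReal.ofReal_coe_nnreal]
      exact (mul_le_mul_right hnorm _).trans h
    exact (ENNReal.ofReal_le_ofReal_iff σ.2).1 h1
  have key := translate_le_exp_mul_add (hw.charFun_restrict I) hε hδ₀ hδ₁ hle hT'm
  have hmv : Measurable fun x => v + x := measurable_const_add v
  rw [Measure.map_apply hXm hT'm,
    Measure.map_apply hXm (s := {x | v + x ∈ T'}) (hmv hT'm)] at key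
  rw [Measure.map_apply hm hcyl, Measure.map_apply hm' hcyl]
  convert! key using 3
  ext ω
  simp only [Set.mem_preimage, mem_cylinder, Set.mem_ofPred_eq, hT', hv, hX]
  refine iff_of_eq (congrArg (· ∈ T) (funext fun i => ?_))
  simp [Finset.restrict]
  abel

/-- If the outputs of a system on adjacent inputs are at `ℓ₂` distance `σ / kappa δ ε` at most, then
adding white Gaussian noise of standard deviation `σ` makes it differentially private. -/
theorem IsWhiteGaussianNoise.differentiallyPrivate (hw : IsWhiteGaussianNoise P σ w) {D : Type*}
    {A : D → D → Prop} {f : D → Signal l} {δ ε : ℝ} (hε : 0 < ε) (hδ₀ : 0 < δ) (hδ₁ : δ < 1)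
    (h : ∀ d d', A d d' → ENNReal.ofReal (kappa δ ε) * l2Norm (f d - f d') ≤ σ) :
    DifferentiallyPrivate P A (fun d ω t => f d t + w t ω) ε δ := by
  refine ⟨fun d => hw.measurable_add _, fun d d' hd => ?_⟩
  have hm := hw.measurable_add (f d)
  have hm' := hw.measurable_add (f d')
  obtain ⟨τ, hτ, hle⟩ := exists_measure_le_mul_add (μ := P.map fun ω t => f d t + w t ω)
    (ν := P.map fun ω t => f d' t + w t ω) (c := ENNReal.ofReal (Real.exp ε))
    (d := ENNReal.ofReal δ) ENNReal.ofReal_ne_top fun S hS => by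
      rw [Measure.map_apply hm hS, Measure.map_apply hm' hS]
      exact hw.measure_le_exp_mul_add hε hδ₀ hδ₁ (h d d' hd) hS
  refine ⟨τ, hτ, fun S hS => ?_⟩
  have := hle S hS
  rwa [Measure.map_apply hm hS, Measure.map_apply hm' hS] at this

end Noise

/-! ### The largest singular value as a gain -/

section SingularValues

variable {𝕜 E F : Type*} [RCLike 𝕜] [NormedAddCommGroup E] [InnerProductSpace 𝕜 E]
  [FiniteDimensional 𝕜 E] [NormedAddCommGroup F] [InnerProductSpace 𝕜 F] [FiniteDimensional 𝕜 F]

/-- The largest singular value bounds the operator norm. -/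
theorem norm_apply_le_singularValues_zero_mul (T : E →ₗ[𝕜] F) (x : E) :
    ‖T x‖ ≤ T.singularValues 0 * ‖x‖ := by
  have hsym := T.isSymmetric_adjoint_comp_self
  -- In an orthonormal eigenbasis of `T* T`, `‖T x‖²` is a sum of squared coordinates weighted by
  -- the squared singular values, each at most the one of index `0`.
  set b := hsym.eigenvectorBasis rfl
  have h1 : ‖T x‖ ^ 2 = ∑ i, hsym.eigenvalues rfl i * ‖b.repr x i‖ ^ 2 := by
    have : (‖T x‖ ^ 2 : ℝ) = RCLike.re (inner 𝕜 x ((LinearMap.adjoint T ∘ₗ T) x)) := by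
      rw [LinearMap.comp_apply, LinearMap.adjoint_inner_right, inner_self_eq_norm_sq]
    rw [this, ← b.repr.inner_map_map, PiLp.inner_apply, map_sum]
    refine Finset.sum_congr rfl fun i _ => ?_
    rw [hsym.eigenvectorBasis_apply_self_apply rfl x i, RCLike.inner_apply, mul_assoc,
      RCLike.mul_conj, ← RCLike.ofReal_pow, ← RCLike.ofReal_mul, RCLike.ofReal_re]
  have h2 : ‖x‖ ^ 2 = ∑ i, ‖b.repr x i‖ ^ 2 := by
    rw [← b.repr.norm_map, EuclideanSpace.norm_sq_eq]
  refine le_of_sq_le_sq ?_ (mul_nonneg (T.singularValues_nonneg 0) (norm_nonneg x))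
  rw [mul_pow, h1, h2, Finset.mul_sum]
  refine Finset.sum_le_sum fun i _ => mul_le_mul_of_nonneg_right ?_ (sq_nonneg _)
  rw [← T.sq_singularValues_fin rfl i]
  exact pow_le_pow_left₀ (T.singularValues_nonneg _)
    (T.singularValues_antitone (Nat.zero_le _)) 2

end SingularValues

/-- The coordinate form in `ℝ≥0∞`, ready to be integrated over frequencies. -/
theorem sum_enorm_sq_mulVec_le {k l : ℕ} (A : Matrix (Fin l) (Fin k) ℂ) (x : Fin k → ℂ) :
    ∑ i, ‖∑ j, A i j * x j‖ₑ ^ 2 ≤ ENNReal.ofReal (sigmaMax A) ^ 2 * ∑ j, ‖x j‖ₑ ^ 2 := by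
  have hE : ∀ {n : ℕ} (y : EuclideanSpace ℂ (Fin n)), ‖y‖ₑ ^ 2 = ∑ i, ‖y i‖ₑ ^ 2 := by
    intro n y
    rw [← ofReal_norm, ← ENNReal.ofReal_pow (norm_nonneg _), EuclideanSpace.norm_sq_eq,
      ENNReal.ofReal_sum_of_nonneg fun _ _ => sq_nonneg _]
    simp_rw [ENNReal.ofReal_pow (norm_nonneg _), ofReal_norm]
  have h := norm_apply_le_singularValues_zero_mul (Matrix.toEuclideanLin A) (WithLp.toLp 2 x)
  have h' := ENNReal.ofReal_le_ofReal h
  rw [ENNReal.ofReal_mul (LinearMap.singularValues_nonneg _ _), ofReal_norm, ofReal_norm] at h'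
  have h2 := pow_le_pow_left₀ (zero_le) h' 2
  rw [mul_pow, hE, hE] at h2
  exact h2

/-! ### Fourier coefficients -/

section Fourier

variable {T : ℝ} [hT : Fact (0 < T)]

/-- The frequency side of a delay: for `m = -s` the coefficient at `-t` becomes the one at `-(t -
s)`. -/
theorem fourierCoeff_fourier_mul (f : AddCircle T → ℂ) (m n : ℤ) :
    fourierCoeff (fun ω => fourier m ω * f ω) n = fourierCoeff f (n - m) := by
  unfold fourierCoeff
  refine integral_congr_ae (ae_of_all _ fun ω => ?_)
  simp only [smul_eq_mul]
  rw [← mul_assoc, ← fourier_add, neg_sub, neg_add_eq_sub]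

theorem memLp_fourier_mul {f : AddCircle T → ℂ} {p : ℝ≥0∞} (hf : MemLp f p AddCircle.haarAddCircle)
    (m : ℤ) : MemLp (fun ω => fourier m ω * f ω) p AddCircle.haarAddCircle := by
  refine hf.of_le ((fourier m).continuous.aestronglyMeasurable.mul hf.1) (ae_of_all _ fun ω => ?_)
  rw [norm_mul, fourier_apply, Circle.norm_coe, one_mul]

theorem tsum_enorm_sq_fourierCoeff {f : AddCircle T → ℂ} (hf : MemLp f 2 AddCircle.haarAddCircle) :
    ∑' n, ‖fourierCoeff f n‖ₑ ^ 2 = ∫⁻ ω, ‖f ω‖ₑ ^ 2 ∂AddCircle.haarAddCircle := by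
  have h := hasSum_sq_fourierCoeff hf.toLp
  have hcongr : fourierCoeff (hf.toLp f) = fourierCoeff f := fourierCoeff_congr_ae hf.coeFn_toLp
  have hint : ∫ ω, ‖hf.toLp f ω‖ ^ 2 ∂AddCircle.haarAddCircle =
      ∫ ω, ‖f ω‖ ^ 2 ∂AddCircle.haarAddCircle :=
    integral_congr_ae (hf.coeFn_toLp.mono fun ω hω => by simp only [hω])
  rw [hcongr, hint] at h
  have he : ∀ z : ℂ, ‖z‖ₑ ^ 2 = ENNReal.ofReal (‖z‖ ^ 2) := fun z => by
    rw [ENNReal.ofReal_pow (norm_nonneg _), ofReal_norm]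
  simp_rw [he]
  rw [← ENNReal.ofReal_tsum_of_nonneg (fun _ => sq_nonneg _) h.summable, h.tsum_eq,
    ofReal_integral_eq_lintegral_ofReal (hf.integrable_norm_pow two_ne_zero)
      (ae_of_all _ fun _ => sq_nonneg _)]

theorem lintegral_enorm_sq_sum_fourier (s : Finset ℕ) (c : ℕ → ℂ) :
    ∫⁻ ω, ‖∑ t ∈ s, c t * fourier (-(t : ℤ)) ω‖ₑ ^ 2 ∂AddCircle.haarAddCircle (T := T) =
      ∑ t ∈ s, ‖c t‖ₑ ^ 2 := by
  have hcont : Continuous fun ω : AddCircle T => ∑ t ∈ s, c t * fourier (-(t : ℤ)) ω := by fun_prop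
  have hmem : ∀ f : C(AddCircle T, ℂ), MemLp f 2 AddCircle.haarAddCircle := fun f =>
    (memLp_top_of_bound f.continuous.aestronglyMeasurable ‖f‖
      (ae_of_all _ f.norm_coe_le_norm)).mono_exponent le_top
  refine (tsum_enorm_sq_fourierCoeff (hmem ⟨_, hcont⟩)).symm.trans ?_
  have hcoeff : ∀ n, fourierCoeff (fun ω : AddCircle T => ∑ t ∈ s, c t * fourier (-(t : ℤ)) ω) n =
      ∑ t ∈ s, if n = -(t : ℤ) then c t else 0 := by
    intro n
    have := fourierCoeff.sum s (fun t (ω : AddCircle T) => c t * fourier (-(t : ℤ)) ω)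
      (fun t _ => ((hmem (fourier (-(t : ℤ)))).integrable one_le_two).const_mul _)
    rw [← Finset.sum_fn, this, Finset.sum_apply]
    refine Finset.sum_congr rfl fun t _ => ?_
    rw [fourierCoeff.const_mul, fourierCoeff_fourier]
    simp [Pi.single_apply]
  simp only [ContinuousMap.coe_mk, hcoeff]
  have hinj : Function.Injective fun t : ℕ => -(t : ℤ) := fun a b h => by simpa using h
  rw [tsum_eq_sum (s := s.map ⟨_, hinj⟩), Finset.sum_map]
  · refine Finset.sum_congr rfl fun t ht => ?_
    simp [ht]
  · intro n hn
    rw [Finset.sum_eq_zero, enorm_zero, zero_pow two_ne_zero]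
    intro t ht
    refine if_neg fun h => hn ?_
    rw [Finset.mem_map]
    exact ⟨t, ht, h.symm⟩

/-- The Fourier coefficients of `∑_t a_t e^(-iωt)` for square summable `a`. -/
theorem fourierCoeff_tsum_fourierLp {a : ℕ → ℂ} (ha : Summable fun t => ‖a t‖ ^ 2) (n : ℤ) :
    fourierCoeff (∑' t : ℕ, a t • fourierLp 2 (-(t : ℤ)) :
      Lp ℂ 2 (AddCircle.haarAddCircle (T := T))) n = if n ≤ 0 then a (-n).toNat else 0 := by
  -- Extend `a` by zero to all frequencies, with time `t` at index `-t`; the Fourier basis then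
  -- provides an `L²` function with coefficients `c`, and the series sums to it.
  set c : ℤ → ℂ := fun n => if n ≤ 0 then a (-n).toNat else 0 with hc
  have hinj : Function.Injective fun t : ℕ => -(t : ℤ) := fun a b h => by simpa using h
  have hcneg : ∀ t : ℕ, c (-(t : ℤ)) = a t := fun t => by simp [hc]
  have hsupp : ∀ n ∉ Set.range fun t : ℕ => -(t : ℤ), c n = 0 := by
    intro n hn
    refine if_neg fun h => hn ⟨(-n).toNat, ?_⟩
    simp only
    omega
  have hmem : Memℓp c 2 := by
    refine memℓp_gen ?_
    simp only [ENNReal.toReal_ofNat, Real.rpow_ofNat]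
    refine (hinj.summable_iff fun n hn => by rw [hsupp n hn]; simp).1 ?_
    simpa [Function.comp_def, hcneg] using ha
  have hsum := (fourierBasis (T := T)).hasSum_repr_symm ⟨c, hmem⟩
  rw [← hinj.hasSum_iff fun n hn => by
    show c n • _ = _
    rw [hsupp n hn, zero_smul]] at hsum
  have hsum' : HasSum (fun t : ℕ => a t • (fourierLp 2 (-(t : ℤ)) :
      Lp ℂ 2 (AddCircle.haarAddCircle (T := T)))) (fourierBasis.repr.symm ⟨c, hmem⟩) := by
    convert! hsum using 2 with t
    simp [hcneg]
  rw [hsum'.tsum_eq, ← fourierBasis_repr, LinearIsometryEquiv.apply_symm_apply]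

end Fourier

/-! ### The `ℓ₂` gain of a system -/

section Gain

variable {k l : ℕ}

theorem enorm_sq_eq_sum (y : EuclideanSpace ℝ (Fin k)) :
    ‖y‖ₑ ^ 2 = ∑ i, ‖((y i : ℝ) : ℂ)‖ₑ ^ 2 := by
  rw [← ofReal_norm, ← ENNReal.ofReal_pow (norm_nonneg _), EuclideanSpace.norm_sq_eq,
    ENNReal.ofReal_sum_of_nonneg fun _ _ => sq_nonneg _]
  refine Finset.sum_congr rfl fun i _ => ?_
  rw [ENNReal.ofReal_pow (norm_nonneg _), ← ofReal_norm, Complex.norm_real]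

theorem delay_iterate_apply (x : Signal k) (s t : ℕ) :
    (delay^[s] x) t = if s ≤ t then x (t - s) else 0 := by
  induction s generalizing t with
  | zero => simp
  | succ s ih =>
    rw [Function.iterate_succ_apply']
    cases t with
    | zero => simp [delay]
    | succ t => simp [delay, ih]

/-- A truncated input is a finite sum of delayed impulses, so linearity and time invariance
determine its output with no continuity assumption on the system. -/
theorem truncate_eq_sum_delay (N : ℕ) (x : Signal k) :
    truncate N x = ∑ s ∈ Finset.range (N + 1), delay^[s] (Pi.single 0 (x s)) := by
  funext t
  rw [Finset.sum_apply]
  simp_rw [delay_iterate_apply]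
  have h : ∀ s, (if s ≤ t then (Pi.single 0 (x s) : Signal k) (t - s) else 0) =
      if s = t then x t else 0 := by
    intro s
    rcases lt_trichotomy s t with hs | rfl | hs
    · rw [if_pos hs.le, if_neg hs.ne, Pi.single_eq_of_ne (by omega)]
    · simp
    · rw [if_neg hs.not_ge, if_neg hs.ne']
  rw [Finset.sum_congr rfl fun s _ => h s, Finset.sum_ite_eq']
  simp [truncate]

theorem IsTimeInvariant.map_delay_iterate {G : Signal k → Signal l} (hG : IsTimeInvariant G) (s : ℕ)
    (x : Signal k) : G (delay^[s] x) = delay^[s] (G x) := by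
  induction s with
  | zero => rfl
  | succ s ih => rw [Function.iterate_succ_apply', hG, ih, Function.iterate_succ_apply']

variable {G : Signal k →ₗ[ℝ] Signal l}

theorem map_single_zero_apply (G : Signal k →ₗ[ℝ] Signal l) (y : EuclideanSpace ℝ (Fin k)) (t : ℕ)
    (i : Fin l) :
    G (Pi.single 0 y) t i = ∑ j, y j * impulseResponse G t i j := by
  have hy : (Pi.single 0 y : Signal k) =
      ∑ j, y j • (Pi.single 0 (EuclideanSpace.single j 1) : Signal k) := by
    have := congrArg (Pi.single (M := fun _ : ℕ => EuclideanSpace ℝ (Fin k)) 0)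
      ((EuclideanSpace.basisFun (Fin k) ℝ).sum_repr y).symm
    rw [this]
    funext t
    rw [Finset.sum_apply]
    rcases eq_or_ne t 0 with rfl | ht
    · simp
    · simp [ht]
  rw [hy, map_sum, Finset.sum_apply]
  simp [impulseResponse]

/-- The output for an input that vanishes after time `N` is its convolution with the impulse
response. -/
theorem map_truncate_apply (hinv : IsTimeInvariant G) (N : ℕ) (x : Signal k) (t : ℕ) (i : Fin l) :
    G (truncate N x) t i = ∑ j, ∑ s ∈ Finset.range (N + 1),
      x s j * if s ≤ t then impulseResponse G (t - s) i j else 0 := by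
  rw [truncate_eq_sum_delay, map_sum, Finset.sum_apply, WithLp.ofLp_sum, Finset.sum_apply,
    Finset.sum_comm]
  refine Finset.sum_congr rfl fun s _ => ?_
  rw [hinv.map_delay_iterate, delay_iterate_apply]
  split_ifs
  · exact map_single_zero_apply G _ _ _
  · simp

/-- Parseval on both sides of `Y = g X`, where `X` is the transform of the truncated input and `g`
the frequency response. Truncation makes `X` a trigonometric polynomial, so `Y` stays in `L²` even
if `hInfNorm G` is infinite. -/
theorem tsum_enorm_sq_map_truncate_le (hinv : IsTimeInvariant G)
    (hG : ∀ i j, Summable fun t => impulseResponse G t i j ^ 2) (N : ℕ) (x : Signal k) :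
    ∑' t, ‖G (truncate N x) t‖ₑ ^ 2 ≤
      hInfNorm G ^ 2 * ∑ s ∈ Finset.range (N + 1), ‖x s‖ₑ ^ 2 := by
  set μ := AddCircle.haarAddCircle (T := 2 * Real.pi)
  set g : Fin l → Fin k → AddCircle (2 * Real.pi) → ℂ := fun i j ω => freqResponse G ω i j with hg
  have hgmem : ∀ i j, MemLp (g i j) 2 μ := fun i j => Lp.memLp _
  have hgcoeff : ∀ i j n, fourierCoeff (g i j) n =
      if n ≤ 0 then ((impulseResponse G (-n).toNat i j : ℝ) : ℂ) else 0 := by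
    intro i j n
    refine fourierCoeff_tsum_fourierLp (T := 2 * Real.pi)
      (a := fun t => ((impulseResponse G t i j : ℝ) : ℂ)) ?_ n
    simpa using hG i j
  set X : Fin k → AddCircle (2 * Real.pi) → ℂ := fun j ω =>
    ∑ s ∈ Finset.range (N + 1), ((x s j : ℝ) : ℂ) * fourier (-(s : ℤ)) ω with hX
  have hXcont : ∀ j, Continuous (X j) := fun j => by simp only [hX]; fun_prop
  -- `Y` is written as a combination of modulated copies of `g`, so that its coefficients can be
  -- read off as the convolution in `map_truncate_apply`; `hYX` recovers the product form.
  set Y : Fin l → AddCircle (2 * Real.pi) → ℂ := fun i => ∑ j, ∑ s ∈ Finset.range (N + 1),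
    fun ω => ((x s j : ℝ) : ℂ) * (fourier (-(s : ℤ)) ω * g i j ω) with hY
  have hYX : ∀ i ω, Y i ω = ∑ j, g i j ω * X j ω := by
    intro i ω
    simp only [hY, hX, Finset.sum_apply, Finset.mul_sum]
    exact Finset.sum_congr rfl fun j _ => Finset.sum_congr rfl fun s _ => by ring
  have hterm : ∀ i j (s : ℕ),
      MemLp (fun ω => ((x s j : ℝ) : ℂ) * (fourier (-(s : ℤ)) ω * g i j ω)) 2 μ := fun i j s =>
    (memLp_fourier_mul (hgmem i j) _).const_mul _
  have hYmem : ∀ i, MemLp (Y i) 2 μ := fun i =>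
    memLp_finsetSum' _ fun j _ => memLp_finsetSum' _ fun s _ => hterm i j s
  have hYcoeff : ∀ i (t : ℕ), fourierCoeff (Y i) (-(t : ℤ)) =
      ((G (truncate N x) t i : ℝ) : ℂ) := by
    intro i t
    rw [hY, fourierCoeff.sum _ _ fun j _ => (memLp_finsetSum' _ fun s _ =>
      hterm i j s).integrable one_le_two, Finset.sum_apply, map_truncate_apply hinv,
      Complex.ofReal_sum]
    refine Finset.sum_congr rfl fun j _ => ?_
    rw [fourierCoeff.sum _ _ fun s _ => (hterm i j s).integrable one_le_two, Finset.sum_apply,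
      Complex.ofReal_sum]
    refine Finset.sum_congr rfl fun s _ => ?_
    rw [fourierCoeff.const_mul, fourierCoeff_fourier_mul, hgcoeff, Complex.ofReal_mul]
    congr 1
    by_cases hst : s ≤ t
    · rw [if_pos (by omega), if_pos hst]
      congr 3
      omega
    · rw [if_neg (by omega), if_neg hst, Complex.ofReal_zero]
  have hinj : Function.Injective fun t : ℕ => -(t : ℤ) := fun a b h => by simpa using h
  have hess : ∀ᵐ ω ∂μ, ENNReal.ofReal (sigmaMax (freqResponse G ω)) ≤ hInfNorm G := by
    rw [hInfNorm, if_pos hG]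
    exact ENNReal.ae_le_essSup _
  calc ∑' t, ‖G (truncate N x) t‖ₑ ^ 2
      = ∑ i, ∑' t : ℕ, ‖fourierCoeff (Y i) (-(t : ℤ))‖ₑ ^ 2 := by
        simp_rw [enorm_sq_eq_sum, hYcoeff]
        exact Summable.tsum_finsetSum fun _ _ => ENNReal.summable
    -- Adding the coefficients at positive indices only enlarges the sum; that they vanish is not
    -- needed.
    _ ≤ ∑ i, ∑' n, ‖fourierCoeff (Y i) n‖ₑ ^ 2 := Finset.sum_le_sum fun i _ =>
        ENNReal.tsum_comp_le_tsum_of_injective hinj fun n => ‖fourierCoeff (Y i) n‖ₑ ^ 2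
    _ = ∫⁻ ω, ∑ i, ‖Y i ω‖ₑ ^ 2 ∂μ := by
        rw [lintegral_finsetSum' _ fun i _ => (hYmem i).1.enorm.pow_const 2]
        exact Finset.sum_congr rfl fun i _ => tsum_enorm_sq_fourierCoeff (hYmem i)
    _ ≤ ∫⁻ ω, hInfNorm G ^ 2 * ∑ j, ‖X j ω‖ₑ ^ 2 ∂μ := by
        refine lintegral_mono_ae (hess.mono fun ω hω => ?_)
        simp only [hYX]
        refine (sum_enorm_sq_mulVec_le (freqResponse G ω) fun j => X j ω).trans ?_
        gcongr
    _ = hInfNorm G ^ 2 * ∑ j, ∑ s ∈ Finset.range (N + 1), ‖((x s j : ℝ) : ℂ)‖ₑ ^ 2 := by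
        have hmeas : ∀ j, Measurable fun ω => ‖X j ω‖ₑ ^ 2 := fun j =>
          (hXcont j).measurable.enorm.pow_const 2
        rw [lintegral_const_mul _ (Finset.measurable_fun_sum _ fun j _ => hmeas j),
          lintegral_finsetSum _ fun j _ => hmeas j]
        congr 1
        exact Finset.sum_congr rfl fun j _ => lintegral_enorm_sq_sum_fourier _ _
    _ = hInfNorm G ^ 2 * ∑ s ∈ Finset.range (N + 1), ‖x s‖ₑ ^ 2 := by
        simp_rw [enorm_sq_eq_sum]
        rw [Finset.sum_comm]

theorem l2Norm_sq (x : Signal k) : l2Norm x ^ 2 = ∑' t, ‖x t‖ₑ ^ 2 := by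
  rw [l2Norm, ← ENNReal.rpow_natCast, ← ENNReal.rpow_mul]
  norm_num

theorem l2Norm_zero : l2Norm (0 : Signal k) = 0 := by
  simp [l2Norm]

theorem l2Norm_eq_zero {x : Signal k} (h : l2Norm x = 0) : x = 0 := by
  have h2 := l2Norm_sq x
  rw [h, zero_pow two_ne_zero, eq_comm, ENNReal.tsum_eq_zero] at h2
  funext t
  simpa using h2 t

/-- The `ℋ_∞` norm bounds the `ℓ₂` gain of a causal linear time-invariant system. -/
theorem l2Norm_map_le (hcausal : IsCausal G) (hinv : IsTimeInvariant G) (x : Signal k) :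
    l2Norm (G x) ≤ hInfNorm G * l2Norm x := by
  -- With gain `∞` the right side is `∞ * 0 = 0` for zero energy, so that case needs linearity;
  -- otherwise it is `∞`.
  rcases eq_or_ne (l2Norm x) 0 with h0 | h0
  · rw [l2Norm_eq_zero h0, map_zero, l2Norm_zero]
    exact zero_le
  by_cases hG : ∀ i j, Summable fun t => impulseResponse G t i j ^ 2
  swap
  · rw [hInfNorm, if_neg hG, ENNReal.top_mul h0]
    exact le_top
  refine (ENNReal.pow_le_pow_left_iff two_ne_zero).1 ?_
  rw [mul_pow, l2Norm_sq, l2Norm_sq, ENNReal.tsum_eq_iSup_nat]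
  refine iSup_le fun N => ?_
  -- Causality: up to time `N` the output only sees the truncated input. The partial sum uses times
  -- below `N`, so the extra time kept by `truncate N` is harmless.
  have hN : ∀ t ∈ Finset.range N, G x t = G (truncate N x) t := by
    intro t ht
    have := congrFun (hcausal N x) t
    rwa [truncate, truncate, if_pos (Finset.mem_range.1 ht).le,
      if_pos (Finset.mem_range.1 ht).le] at this
  calc ∑ t ∈ Finset.range N, ‖G x t‖ₑ ^ 2
      = ∑ t ∈ Finset.range N, ‖G (truncate N x) t‖ₑ ^ 2 :=
        Finset.sum_congr rfl fun t ht => by rw [hN t ht]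
    _ ≤ ∑' t, ‖G (truncate N x) t‖ₑ ^ 2 := ENNReal.sum_le_tsum _
    _ ≤ hInfNorm G ^ 2 * ∑ s ∈ Finset.range (N + 1), ‖x s‖ₑ ^ 2 :=
        tsum_enorm_sq_map_truncate_le hinv hG N x
    _ ≤ _ := by
        gcongr
        exact ENNReal.sum_le_tsum _

end Gain

end PrivateFilter

/-! ### Privacy of the dynamic Gaussian mechanism -/

theorem mainTheorem4 {Ω : Type*} [MeasurableSpace Ω] (P : Measure Ω) [IsProbabilityMeasure P]
    (n l : ℕ) (m : Fin n → ℕ)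
    (G : ∀ i, PrivateFilter.Signal (m i) →ₗ[ℝ] PrivateFilter.Signal l)
    (hcausal : ∀ i, PrivateFilter.IsCausal (G i))
    (hinv : ∀ i, PrivateFilter.IsTimeInvariant (G i))
    (b : Fin n → ℝ≥0) (ε δ : ℝ) (hε : 0 < ε) (hδ₀ : 0 < δ) (hδ₁ : δ < 1)
    (σ : ℝ≥0)
    (hσ : ENNReal.ofReal (PrivateFilter.kappa δ ε) *
      (⨆ i, PrivateFilter.hInfNorm (G i) * (b i : ℝ≥0∞)) ≤ (σ : ℝ≥0∞))
    (w : ℕ → Ω → EuclideanSpace ℝ (Fin l))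
    (hw : PrivateFilter.IsWhiteGaussianNoise P σ w) :
    PrivateFilter.DifferentiallyPrivate P (PrivateFilter.Adj b)
      (PrivateFilter.mechanism G w) ε δ := by
  have hmech : PrivateFilter.mechanism G w =
      fun u ω t => (∑ i, G i (u i) : PrivateFilter.Signal l) t + w t ω := rfl
  rw [hmech]
  refine hw.differentiallyPrivate (f := fun u : ∀ i, PrivateFilter.Signal (m i) => ∑ i, G i (u i))
    hε hδ₀ hδ₁ fun u u' huu' => ?_
  obtain ⟨i, hi, hne⟩ := huu'
  -- Every participant except `i` cancels, so the sensitivity is a supremum over participants and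
  -- not a sum.
  have hdiff : ∑ j, G j (u j) - ∑ j, G j (u' j) = G i (u i - u' i) := by
    rw [← Finset.sum_sub_distrib, Finset.sum_eq_single_of_mem i (Finset.mem_univ i) fun j _ hj => by
      rw [hne j hj, sub_self], map_sub]
  have hgain : PrivateFilter.l2Norm (∑ j, G j (u j) - ∑ j, G j (u' j)) ≤
      ⨆ i, PrivateFilter.hInfNorm (G i) * (b i : ℝ≥0∞) := by
    rw [hdiff]
    exact ((PrivateFilter.l2Norm_map_le (hcausal i) (hinv i) _).trans (mul_le_mul_right hi _)).trans
      (le_iSup (fun i => PrivateFilter.hInfNorm (G i) * (b i : ℝ≥0∞)) i)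
  exact (mul_le_mul_right hgain _).trans hσ
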